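/- Let $E$ be a Dedekind complete Riesz space with universal completion $E^u$. A conditional expectation operator on $E$ is a positive order continuous linear projection $T:E\to E$ whose range $R(T)$ is a Dedekind complete Riesz subspace of $E$ and which maps every weak order unit of $E$ to a weak order unit. $E$ is called $T$-universally complete (that is, $E=L^1(T)$) if every upwards directed net $(f_\lambda)$ in $E_+$ for which $(Tf_\lambda)$ is order bounded in $E^u$ is order convergent in $E$. A conditional expectation operator $U$ on $E$ is compatible with $T$ if $TU=T=UT$. Let $T$ be a conditional expectation operator on $E$, let $E$ be $T$-universally complete, and let $e$ be a weak order unit of $E$ with $e=Te$. Write $\cdot$ for the $f$-algebra product with unit $e$, and let $U$ and $V$ be conditional expectation operators on $E$ compatible with $T$. Let $\mathcal B(U)$ be the set of band projections $P$ on $E$ with $Pe\in R(U)$, likewise $\mathcal B(V)$, and put $$\alpha_T(U,V)=\sup\{\,|TPQe-TPe\cdot TQe| \;:\; P\in\mathcal B(U),\ Q\in\mathcal B(V)\,\}.$$ Let $L^\infty(T)=\{f\in E : |f|\le g \text{ for some } g\in R(T)_+\}$, and put $\|f\|_{T,1}=T|f|$ for $f\in E$ and $\|f\|_{T,\infty}=\inf\{g\in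 R(T)_+ : |f|\le g\}$ for $f\in L^\infty(T)$. Then for every $f\in R(V)\cap L^\infty(T)$, $$\|Uf-Tf\|_{T,1}\le 4\,\alpha_T(U,V)\cdot\|f\|_{T,\infty}.$$ -/

import Mathlib

universe u

namespace RieszMixing

section Defs

/-! Throughout, a Dedekind complete Riesz space is a real vector space with a conditionally complete
lattice order that is compatible with the linear structure. -/

variable {E : Type u} [AddCommGroup E] [ConditionallyCompleteLattice E] [IsOrderedAddMonoid E]
  [Module ℝ E] [IsOrderedModule ℝ E]

/-- A weak order unit: a positive element that is disjoint only from `0`. -/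
def IsWeakOrderUnit (e : E) : Prop :=
  0 ≤ e ∧ ∀ f : E, e ⊓ |f| = 0 → f = 0

/-- Order continuity of a positive operator: `D ↓ 0` implies `T D ↓ 0`. -/
def IsOrderContinuous (T : E →ₗ[ℝ] E) : Prop :=
  ∀ D : Set E, D.Nonempty → DirectedOn (· ≥ ·) D → IsGLB D 0 → IsGLB (T '' D) 0

/-- Conditional expectation operators: positive order continuous linear projections whose range is
a Dedekind complete Riesz subspace and which map weak order units to weak order units. -/
structure IsConditionalExpectation (T : E →ₗ[ℝ] E) : Prop where
  positive : ∀ f : E, 0 ≤ f → 0 ≤ T f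
  orderContinuous : IsOrderContinuous T
  projection : ∀ f : E, T (T f) = T f
  range_sup : ∀ f ∈ LinearMap.range T, ∀ g ∈ LinearMap.range T, f ⊔ g ∈ LinearMap.range T
  range_complete : ∀ D : Set (LinearMap.range T), D.Nonempty → BddAbove D → ∃ s, IsLUB D s
  weakOrderUnit : ∀ e : E, IsWeakOrderUnit e → IsWeakOrderUnit (T e)

/-- `U` is compatible with `T`: `TU = T = UT`. -/
def IsCompatible (U T : E →ₗ[ℝ] E) : Prop :=
  T ∘ₗ U = T ∧ U ∘ₗ T = T

variable (E) in
/-- `E` is universally complete: on top of Dedekind completeness (contained in the classes), every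
nonempty set of mutually disjoint elements has a supremum. -/
def IsUniversallyComplete : Prop :=
  ∀ S : Set E, S.Nonempty → S.Pairwise (fun x y => |x| ⊓ |y| = 0) → ∃ s, IsLUB S s

variable (E) in
/-- A universal completion of `E`: a universally complete Riesz space that contains `E` (through an
injective linear lattice homomorphism) as an order dense Riesz subspace. -/
structure UniversalCompletion where
  carrier : Type u
  [addCommGroup : AddCommGroup carrier]
  [lattice : ConditionallyCompleteLattice carrier]
  [orderedAdd : IsOrderedAddMonoid carrier]
  [module : Module ℝ carrier]
  [orderedModule : IsOrderedModule ℝ carrier]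
  universallyComplete : IsUniversallyComplete carrier
  incl : E →ₗ[ℝ] carrier
  incl_sup : ∀ f g : E, incl (f ⊔ g) = incl f ⊔ incl g
  incl_injective : Function.Injective incl
  incl_dense : ∀ x : carrier, 0 < x → ∃ f : E, 0 < incl f ∧ incl f ≤ x

attribute [instance] UniversalCompletion.addCommGroup UniversalCompletion.lattice
  UniversalCompletion.orderedAdd UniversalCompletion.module UniversalCompletion.orderedModule

/-- `E` is `T`-universally complete, i.e. `E = L¹(T)`: every upwards directed family of positive
elements whose image under `T` is order bounded in the universal completion of `E` (which is unique
up to isomorphism) is order convergent in `E`. For an upwards directed family, order convergence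
means that its supremum exists. -/
def IsTUniversallyComplete (T : E →ₗ[ℝ] E) : Prop :=
  ∀ (C : UniversalCompletion E) (D : Set E), D.Nonempty → (∀ f ∈ D, 0 ≤ f) →
    DirectedOn (· ≤ ·) D → BddAbove (C.incl '' (T '' D)) → ∃ s : E, IsLUB D s

/-- Band projections: linear projections `P` with `0 ≤ P ≤ I`. -/
structure IsBandProjection (P : E →ₗ[ℝ] E) : Prop where
  projection : ∀ f : E, P (P f) = P f
  positive : ∀ f : E, 0 ≤ f → 0 ≤ P f
  le_id : ∀ f : E, 0 ≤ f → P f ≤ f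

/-- `𝓑(U)`: the band projections `P` with `P e ∈ R(U)`. -/
def bandProjections (e : E) (U : E →ₗ[ℝ] E) : Set (E →ₗ[ℝ] E) :=
  {P | IsBandProjection P ∧ P e ∈ LinearMap.range U}

/-- The set of all `s t p` with `p` a component of `e`, `s, t ≥ 0`, `s p ≤ a` and `t p ≤ b`. -/
def prodSet (e a b : E) : Set E :=
  {x | ∃ (p : E) (s t : ℝ), p ⊓ (e - p) = 0 ∧ 0 ≤ s ∧ 0 ≤ t ∧ s • p ≤ a ∧ t • p ≤ b ∧
    x = (s * t) • p}

/-- The product `a · b` of two positive elements, with respect to the f-algebra structure whose unit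
is the weak order unit `e`. In the representation by extended-real continuous functions on a Stonean
space with `e = 1`, the components of `e` are the indicators of the clopen sets, and the pointwise
product of `a, b ≥ 0` is the supremum of the functions `s t 1_K` with `K` clopen, `s 1_K ≤ a` and
`t 1_K ≤ b`. -/
noncomputable def unitProd (e a b : E) : E := sSup (prodSet e a b)

/-- The set of all `|T P Q e - T P e · T Q e|` with `P ∈ 𝓑(U)` and `Q ∈ 𝓑(V)`. -/
def mixingSet (e : E) (T U V : E →ₗ[ℝ] E) : Set E :=
  {x | ∃ P ∈ bandProjections e U, ∃ Q ∈ bandProjections e V,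
    x = |T (P (Q e)) - unitProd e (T (P e)) (T (Q e))|}

/-- The `T`-conditional strong mixing coefficient `α_T(U, V)`. -/
noncomputable def strongMixing (e : E) (T U V : E →ₗ[ℝ] E) : E := sSup (mixingSet e T U V)

/-- `L^∞(T)`: the elements of `E = L¹(T)` that are bounded by some `g ∈ R(T)₊`. -/
def LInfty (T : E →ₗ[ℝ] E) : Set E :=
  {f | ∃ g ∈ LinearMap.range T, 0 ≤ g ∧ |f| ≤ g}

/-- `‖f‖_{T,1} = T|f|`. -/
def normOne (T : E →ₗ[ℝ] E) (f : E) : E := T |f|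

/-- `‖f‖_{T,∞} = inf {g ∈ R(T)₊ : |f| ≤ g}`. -/
noncomputable def normInfty (T : E →ₗ[ℝ] E) (f : E) : E :=
  sInf {g | g ∈ LinearMap.range T ∧ 0 ≤ g ∧ |f| ≤ g}

/-! The suprema that define the products and the mixing coefficient are suprema of nonempty sets
that are bounded above. -/

theorem prodSet_le {e a b : E} (ha : a ≤ e) (hb : 0 ≤ b) :
    b ∈ upperBounds (prodSet e a b) := by
  rintro x ⟨p, s, t, hp, hs, ht, hsa, htb, rfl⟩
  have hp0 : 0 ≤ p := hp ▸ inf_le_left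
  rcases le_or_gt s 1 with h | h
  · refine le_trans ?_ htb
    exact smul_le_smul_of_nonneg_right (by nlinarith) hp0
  · have h1 : min 1 (s - 1) • p ≤ p ⊓ (e - p) := by
      refine le_inf ?_ ?_
      · calc min 1 (s - 1) • p ≤ (1 : ℝ) • p :=
            smul_le_smul_of_nonneg_right (min_le_left _ _) hp0
          _ = p := one_smul _ _
      · calc min 1 (s - 1) • p ≤ (s - 1) • p :=
            smul_le_smul_of_nonneg_right (min_le_right _ _) hp0
          _ = s • p - p := by rw [sub_smul, one_smul]
          _ ≤ e - p := sub_le_sub_right (hsa.trans ha) _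
    have hm : 0 < min 1 (s - 1) := lt_min one_pos (by linarith)
    rw [hp] at h1
    have h2 : min 1 (s - 1) • p = 0 := le_antisymm h1 (smul_nonneg hm.le hp0)
    have h3 : p = 0 := (smul_eq_zero.mp h2).resolve_left hm.ne'
    rw [h3, smul_zero]
    exact hb

set_option linter.unusedSectionVars false in
theorem zero_mem_prodSet {e a b : E} (he : 0 ≤ e) (ha : 0 ≤ a) (hb : 0 ≤ b) :
    0 ∈ prodSet e a b :=
  ⟨0, 0, 0, by simpa using he, le_rfl, le_rfl, by simpa using ha, by simpa using hb, by simp⟩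

theorem isLUB_unitProd {e a b : E} (ha0 : 0 ≤ a) (ha : a ≤ e) (hb : 0 ≤ b) :
    IsLUB (prodSet e a b) (unitProd e a b) :=
  isLUB_csSup ⟨0, zero_mem_prodSet (ha0.trans ha) ha0 hb⟩ ⟨b, prodSet_le ha hb⟩

theorem isLUB_strongMixing {e : E} {T U V : E →ₗ[ℝ] E} (he : 0 ≤ e)
    (hT : IsConditionalExpectation T) (hTe : T e = e) :
    IsLUB (mixingSet e T U V) (strongMixing e T U V) ∧ strongMixing e T U V ≤ e := by
  have hle : ∀ f, f ≤ e → T f ≤ e := fun f hf => by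
    have := hT.positive (e - f) (sub_nonneg.mpr hf)
    rw [map_sub, hTe] at this
    exact sub_nonneg.mp this
  have hub : e ∈ upperBounds (mixingSet e T U V) := by
    rintro x ⟨P, hP, Q, hQ, rfl⟩
    have hPe := hP.1.positive e he
    have hQe := hQ.1.positive e he
    have hP1 := hP.1.le_id e he
    have hQ1 := hQ.1.le_id e he
    have h := isLUB_unitProd (hT.positive _ hPe) (hle _ hP1) (hT.positive _ hQe)
    have h0 := h.1 (zero_mem_prodSet he (hT.positive _ hPe) (hT.positive _ hQe))
    have h1 := (h.2 (prodSet_le (hle _ hP1) (hT.positive _ hQe))).trans (hle _ hQ1)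
    have h2 := hT.positive _ (hP.1.positive _ hQe)
    have h3 := hle _ ((hP.1.le_id _ hQe).trans hQ1)
    refine sup_le ?_ ?_
    · have := sub_le_sub h3 h0
      simpa using this
    · have := sub_le_sub h1 h2
      simpa using this
  have h0 : (0 : E →ₗ[ℝ] E) ∈ bandProjections e U ∧ (0 : E →ₗ[ℝ] E) ∈ bandProjections e V :=
    ⟨⟨⟨fun _ => rfl, fun _ _ => le_rfl, fun _ h => h⟩, zero_mem _⟩,
      ⟨⟨fun _ => rfl, fun _ _ => le_rfl, fun _ h => h⟩, zero_mem _⟩⟩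
  have hne : (mixingSet e T U V).Nonempty := ⟨_, 0, h0.1, 0, h0.2, rfl⟩
  exact ⟨isLUB_csSup hne ⟨e, hub⟩, csSup_le hne hub⟩

end Defs

end RieszMixing

/-!
The proof works with band projections instead of the `f`-algebra product: a band projection `P`
acts as multiplication by `P e`, and for a conditional expectation `W` with `W e = e` and
`P e ∈ R(W)` it commutes with `W` (averaging, `IsConditionalExpectation.map_bandProjection`).

Let `h = U f - T f` and let `P ∈ 𝓑(U)` be the projection onto the band where `h > 0`. Since
`T h = 0`, we have `T|h| = 2 T P h`, and `T U = T` together with averaging turns this into twice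
the conditional covariance `cov x = T P x - T P T x` at `x = f`
(`map_abs_sub_eq_conditionalCov`).

For a component `Q e` with `Q ∈ 𝓑(V)`, the covariance is at most `α = α_T(U, V)`, because
`T P e · T Q e ≤ T P T Q e` (`unitProd_le_map`). An element `x ∈ R(V)` with `|x| ≤ c e` is, after
the shift by `c e` (on which the covariance vanishes), a limit of `2 c` times averages of such
components, so that `cov x ≤ 2 c α` (`conditionalCov_le`).

Finally `f` is only bounded by `N = ‖f‖_{T,∞} ∈ R(T)`, which need not be bounded by a multiple of
`e`. On a band with projection `J`, `J e ∈ R(T)`, where `N ≤ t e`, the bounded case applies to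
`J f`, and `J` commutes with `T` and `V`; hence `J cov f ≤ 2 t J α`. Cutting `N` into spectral
slices on which it is constant up to `ε` (`le_of_forall_slice`) and letting `ε → 0`, these local
estimates add up to `cov f ≤ 2 α · N` (`le_unitProd`).
-/

namespace RieszMixing

section Proof

set_option linter.unusedSectionVars false

variable {E : Type u} [AddCommGroup E] [ConditionallyCompleteLattice E] [IsOrderedAddMonoid E]
  [Module ℝ E] [IsOrderedModule ℝ E]

/-! ### Dedekind complete Riesz spaces are Archimedean -/

theorem nonpos_of_forall_nsmul_le {w b : E} (h : ∀ n : ℕ, n • w ≤ b) : w ≤ 0 := by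
  have hs := isLUB_csSup (Set.range_nonempty fun n : ℕ => n • w)
    ⟨b, by rintro _ ⟨n, rfl⟩; exact h n⟩
  have : sSup (Set.range fun n : ℕ => n • w) ≤ sSup (Set.range fun n : ℕ => n • w) - w := by
    refine hs.2 ?_
    rintro _ ⟨n, rfl⟩
    have := hs.1 ⟨n + 1, rfl⟩
    rw [le_sub_iff_add_le]
    simpa only [succ_nsmul] using this
  simpa using this

theorem le_of_forall_pos_le_add_smul {x y b : E} (hb : 0 ≤ b)
    (h : ∀ ε : ℝ, 0 < ε → x ≤ y + ε • b) : x ≤ y := by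
  rw [← sub_nonpos]
  refine nonpos_of_forall_nsmul_le (b := b) fun n => ?_
  rcases Nat.eq_zero_or_pos n with rfl | hn
  · simpa using hb
  · have hn' : (0 : ℝ) < n := by exact_mod_cast hn
    have h1 := smul_le_smul_of_nonneg_left
      (sub_le_iff_le_add'.mpr (h (n : ℝ)⁻¹ (inv_pos.mpr hn'))) hn'.le
    rwa [smul_smul, mul_inv_cancel₀ hn'.ne', one_smul, Nat.cast_smul_eq_nsmul] at h1

/-! ### Disjoint complements and the projection onto a principal band -/

theorem add_inf_le_inf_add_inf {a b c : E} (ha : 0 ≤ a) (hb : 0 ≤ b) (hc : 0 ≤ c) :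
    (a + b) ⊓ c ≤ a ⊓ c + b ⊓ c := by
  rw [add_inf, inf_add, inf_add]
  refine le_inf (le_inf inf_le_left (inf_le_right.trans ?_))
    (le_inf (inf_le_right.trans ?_) (inf_le_right.trans ?_))
  · exact le_add_of_nonneg_right hb
  · exact le_add_of_nonneg_left ha
  · exact le_add_of_nonneg_left hc

theorem nsmul_inf_eq_zero {a c : E} (ha : 0 ≤ a) (hc : 0 ≤ c) (h : a ⊓ c = 0) (n : ℕ) :
    (n • a) ⊓ c = 0 := by
  induction n with
  | zero => simpa using hc
  | succ n ih =>
    refine le_antisymm ?_ (le_inf (nsmul_nonneg ha _) hc)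
    rw [succ_nsmul]
    exact (add_inf_le_inf_add_inf (nsmul_nonneg ha n) ha hc).trans (by rw [ih, h, add_zero])

theorem inf_eq_zero_of_le {a a' c : E} (ha : 0 ≤ a) (haa : a ≤ a') (hc : 0 ≤ c)
    (h : a' ⊓ c = 0) : a ⊓ c = 0 :=
  le_antisymm ((inf_le_inf_right c haa).trans h.le) (le_inf ha hc)

theorem abs_smul_le_nsmul (r : ℝ) (y : E) : |r • y| ≤ ⌈|r|⌉₊ • |y| := by
  have h1 : |r| • |y| ≤ ⌈|r|⌉₊ • |y| := by
    rw [← Nat.cast_smul_eq_nsmul ℝ]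
    exact smul_le_smul_of_nonneg_right (Nat.le_ceil _) (abs_nonneg _)
  have h2 : ∀ (s : ℝ) (y : E), s • y ≤ |s| • |y| := fun s y => by
    rcases abs_cases s with ⟨h, h'⟩ | ⟨h, h'⟩
    · rw [h]
      exact smul_le_smul_of_nonneg_left (le_abs_self y) h'
    · rw [h, ← neg_smul_neg s]
      exact smul_le_smul_of_nonneg_left (neg_le_abs y) (by linarith)
  refine le_trans (abs_le'.mpr ⟨h2 r y, ?_⟩) h1
  have := h2 (-r) y
  rwa [abs_neg, neg_smul] at this

/-- The disjoint complement `Sᵈ` of a set `S`: the elements disjoint from every element of `S`. -/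
def disjointCompl (S : Set E) : Submodule ℝ E where
  carrier := {y | ∀ z ∈ S, |y| ⊓ |z| = 0}
  zero_mem' z _ := by simp
  add_mem' {a b} ha hb z hz := by
    refine inf_eq_zero_of_le (abs_nonneg _) (abs_add_le a b) (abs_nonneg _) ?_
    refine le_antisymm ((add_inf_le_inf_add_inf (abs_nonneg _) (abs_nonneg _)
      (abs_nonneg _)).trans ?_) (le_inf (add_nonneg (abs_nonneg _) (abs_nonneg _)) (abs_nonneg _))
    rw [ha z hz, hb z hz, add_zero]
  smul_mem' r y hy z hz :=
    inf_eq_zero_of_le (abs_nonneg _) (abs_smul_le_nsmul r y) (abs_nonneg _)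
      (nsmul_inf_eq_zero (abs_nonneg _) (abs_nonneg _) (hy z hz) _)

theorem mem_disjointCompl_singleton {x y : E} : y ∈ disjointCompl {x} ↔ |y| ⊓ |x| = 0 :=
  ⟨fun h => h x rfl, by rintro h _ rfl; exact h⟩

/-- The Riesz decomposition of `y ≥ 0` with respect to the band generated by `x`: its component in
the band is `supₙ (y ⊓ n |x|)`. -/
theorem exists_band_decomposition (x : E) {y : E} (hy : 0 ≤ y) :
    ∃ z, IsLUB (Set.range fun n : ℕ => y ⊓ n • |x|) z ∧ 0 ≤ z ∧ z ≤ y ∧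
      z ∈ disjointCompl (disjointCompl {x} : Set E) ∧ y - z ∈ disjointCompl {x} := by
  have hs := isLUB_csSup (Set.range_nonempty fun n : ℕ => y ⊓ n • |x|)
    ⟨y, by rintro _ ⟨n, rfl⟩; exact inf_le_left⟩
  set z := sSup (Set.range fun n : ℕ => y ⊓ n • |x|)
  have h0 : 0 ≤ z := (le_inf hy (by simp)).trans (hs.1 ⟨0, rfl⟩)
  have h1 : z ≤ y := hs.2 (by rintro _ ⟨n, rfl⟩; exact inf_le_left)
  refine ⟨z, hs, h0, h1, ?_, ?_⟩
  · intro w hw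
    rw [abs_of_nonneg h0]
    refine le_antisymm ?_ (le_inf h0 (abs_nonneg _))
    have : z ≤ z - z ⊓ |w| := by
      refine hs.2 ?_
      rintro _ ⟨n, rfl⟩
      have hc : 0 ≤ y ⊓ n • |x| := le_inf hy (nsmul_nonneg (abs_nonneg _) _)
      have hd : (y ⊓ n • |x|) ⊓ (z ⊓ |w|) = 0 := by
        refine inf_eq_zero_of_le hc inf_le_right (le_inf h0 (abs_nonneg _)) ?_
        refine nsmul_inf_eq_zero (abs_nonneg _) (le_inf h0 (abs_nonneg _)) ?_ n
        rw [inf_comm]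
        exact inf_eq_zero_of_le (le_inf h0 (abs_nonneg _)) inf_le_right (abs_nonneg _)
          (mem_disjointCompl_singleton.mp hw)
      rw [le_sub_iff_add_le, ← inf_add_sup, hd, zero_add]
      exact sup_le (hs.1 ⟨n, rfl⟩) inf_le_left
    simpa using this
  · rw [mem_disjointCompl_singleton, abs_of_nonneg (sub_nonneg.mpr h1)]
    refine le_antisymm ?_ (le_inf (sub_nonneg.mpr h1) (abs_nonneg _))
    have : z ≤ z - (y - z) ⊓ |x| := by
      refine hs.2 ?_
      rintro _ ⟨n, rfl⟩
      rw [le_sub_iff_add_le]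
      refine le_trans (le_inf ?_ ?_) (hs.1 ⟨n + 1, rfl⟩)
      · calc y ⊓ n • |x| + (y - z) ⊓ |x| ≤ z + (y - z) := add_le_add (hs.1 ⟨n, rfl⟩) inf_le_left
          _ = y := by abel
      · rw [succ_nsmul]
        exact add_le_add inf_le_right inf_le_right
    simpa using this

theorem isCompl_band (x : E) :
    IsCompl (disjointCompl (disjointCompl {x} : Set E)) (disjointCompl {x}) := by
  constructor
  · rw [Submodule.disjoint_def]
    intro y h1 h2
    have := h1 y h2
    rw [inf_idem] at this
    exact le_antisymm (this ▸ le_abs_self y) (neg_nonpos.mp (this ▸ neg_le_abs y))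
  · rw [codisjoint_iff, Submodule.eq_top_iff']
    have key : ∀ y : E, 0 ≤ y →
        y ∈ disjointCompl (disjointCompl {x} : Set E) ⊔ disjointCompl {x} := fun y hy => by
      obtain ⟨z, -, -, -, h1, h2⟩ := exists_band_decomposition x hy
      exact Submodule.mem_sup.mpr ⟨z, h1, _, h2, by abel⟩
    intro y
    rw [← posPart_sub_negPart y]
    exact Submodule.sub_mem _ (key _ (posPart_nonneg y)) (key _ (negPart_nonneg y))

/-- The projection onto the band `{x}ᵈᵈ` generated by `x`, along `{x}ᵈ`. -/
noncomputable def bandProj (x : E) : E →ₗ[ℝ] E := Submodule.projection _ _ (isCompl_band x)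

theorem bandProj_of_disjoint {x y : E} (h : |y| ⊓ |x| = 0) : bandProj x y = 0 :=
  (Submodule.projection_apply_eq_zero_iff _).mpr (mem_disjointCompl_singleton.mpr h)

theorem bandProj_self (x : E) : bandProj x x = x :=
  Submodule.projection_apply_of_mem_left _ fun y hy => by
    rw [inf_comm]
    exact mem_disjointCompl_singleton.mp hy

theorem bandProj_eq {x y z : E} (h1 : z ∈ disjointCompl (disjointCompl {x} : Set E))
    (h2 : y - z ∈ disjointCompl {x}) : bandProj x y = z := by
  have h3 : bandProj x z = z := Submodule.projection_apply_of_mem_left _ h1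
  have h4 : bandProj x (y - z) = 0 := (Submodule.projection_apply_eq_zero_iff _).mpr h2
  rw [map_sub, h3] at h4
  exact sub_eq_zero.mp h4

theorem isLUB_bandProj (x : E) {y : E} (hy : 0 ≤ y) :
    IsLUB (Set.range fun n : ℕ => y ⊓ n • |x|) (bandProj x y) := by
  obtain ⟨z, hz, -, -, h1, h2⟩ := exists_band_decomposition x hy
  rwa [bandProj_eq h1 h2]

theorem isBandProjection_bandProj (x : E) : IsBandProjection (bandProj x) where
  projection y :=
    Submodule.projection_apply_of_mem_left _ (Submodule.projection_apply_mem (isCompl_band x) y)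
  positive y hy := by
    obtain ⟨z, -, h0, -, h1, h2⟩ := exists_band_decomposition x hy
    rwa [bandProj_eq h1 h2]
  le_id y hy := by
    obtain ⟨z, -, -, h0, h1, h2⟩ := exists_band_decomposition x hy
    rwa [bandProj_eq h1 h2]

theorem bandProj_posPart (y : E) : bandProj y⁺ y = y⁺ := by
  have h : bandProj y⁺ y⁻ = 0 := bandProj_of_disjoint (by
    rw [abs_of_nonneg (negPart_nonneg y), abs_of_nonneg (posPart_nonneg y), inf_comm,
      posPart_inf_negPart_eq_zero])
  have h2 := map_sub (bandProj y⁺) y⁺ y⁻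
  rwa [posPart_sub_negPart, bandProj_self, h, sub_zero] at h2

/-- An element is the supremum of its truncations by the multiples of a weak order unit. -/
theorem IsWeakOrderUnit.isLUB_inf_nsmul {e : E} (he : IsWeakOrderUnit e) {y : E} (hy : 0 ≤ y) :
    IsLUB (Set.range fun n : ℕ => y ⊓ n • e) y := by
  obtain ⟨z, hz, -, -, h1, h2⟩ := exists_band_decomposition e hy
  rw [mem_disjointCompl_singleton, abs_of_nonneg he.1, inf_comm] at h2
  rw [abs_of_nonneg he.1] at hz
  rwa [← sub_eq_zero.mp (he.2 _ h2)] at hz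

/-! ### The calculus of band projections -/

theorem apply_eq_of_nonneg {f g : E →ₗ[ℝ] E} (h : ∀ x, 0 ≤ x → f x = g x) (x : E) : f x = g x := by
  rw [← posPart_sub_negPart x, map_sub, map_sub, h _ (posPart_nonneg x), h _ (negPart_nonneg x)]

namespace IsBandProjection

variable {P Q : E →ₗ[ℝ] E}

theorem mono (hP : IsBandProjection P) {x y : E} (h : x ≤ y) : P x ≤ P y := by
  have := hP.positive _ (sub_nonneg.mpr h)
  rwa [map_sub, sub_nonneg] at this

theorem compl (hP : IsBandProjection P) : IsBandProjection (1 - P) where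
  projection f := by simp [hP.projection]
  positive f hf := sub_nonneg.mpr (hP.le_id f hf)
  le_id f hf := sub_le_self _ (hP.positive f hf)

theorem eq_self_of_le (hP : IsBandProjection P) {x y : E} (hx : 0 ≤ x) (hxy : x ≤ P y) :
    P x = x := by
  have h := hP.compl.mono hxy
  have h0 : (1 - P) (P y) = 0 := by simp [hP.projection]
  rw [h0] at h
  exact le_antisymm (hP.le_id x hx) (sub_nonpos.mp h)

theorem comm (hP : IsBandProjection P) (hQ : IsBandProjection Q) (x : E) :
    P (Q x) = Q (P x) := by
  have key : ∀ {P : E →ₗ[ℝ] E}, IsBandProjection P → ∀ x, 0 ≤ x → P (Q (P x)) = Q (P x) :=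
    fun hP x hx => hP.eq_self_of_le (hQ.positive _ (hP.positive _ hx))
      (hQ.le_id _ (hP.positive _ hx))
  refine apply_eq_of_nonneg (f := P ∘ₗ Q) (g := Q ∘ₗ P) (fun x hx => ?_) x
  have h1 := key hP x hx
  have h2 := key hP.compl x hx
  simp only [LinearMap.sub_apply, Module.End.one_apply, map_sub, h1] at h2
  simp only [LinearMap.comp_apply]
  rw [sub_self, sub_zero] at h2
  exact sub_right_injective h2

theorem comp (hP : IsBandProjection P) (hQ : IsBandProjection Q) : IsBandProjection (P ∘ₗ Q) where
  projection f := by simp only [LinearMap.comp_apply, hP.comm hQ, hP.projection, hQ.projection]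
  positive f hf := hP.positive _ (hQ.positive f hf)
  le_id f hf := (hP.le_id _ (hQ.positive f hf)).trans (hQ.le_id f hf)

theorem abs_map_le (hP : IsBandProjection P) (x : E) : |P x| ≤ P |x| :=
  abs_le'.mpr ⟨hP.mono (le_abs_self x), by rw [← map_neg]; exact hP.mono (neg_le_abs x)⟩

theorem disjoint_compl (hP : IsBandProjection P) {x y : E} (hx : 0 ≤ x) (hy : 0 ≤ y) :
    P x ⊓ (y - P y) = 0 := by
  have h0 : 0 ≤ P x ⊓ (y - P y) := le_inf (hP.positive x hx) (hP.compl.positive y hy)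
  have h1 := hP.eq_self_of_le h0 inf_le_left
  have h2 : P (P x ⊓ (y - P y)) ≤ P (y - P y) := hP.mono inf_le_right
  rw [h1, map_sub, hP.projection, sub_self] at h2
  exact le_antisymm h2 h0

theorem map_posPart_eq_zero (hP : IsBandProjection P) {x : E} (h : P x ≤ 0) : P x⁺ = 0 := by
  have h1 : P x⁺ ≤ P x⁻ := by
    rwa [← sub_nonpos, ← map_sub, posPart_sub_negPart]
  refine le_antisymm ?_ (hP.positive _ (posPart_nonneg x))
  rw [← posPart_inf_negPart_eq_zero x]
  exact le_inf (hP.le_id _ (posPart_nonneg x)) (h1.trans (hP.le_id _ (negPart_nonneg x)))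

end IsBandProjection

/-- The projection onto the band of `(y - t e)⁺` is the projection onto the band where `y > t e`:
`y ≥ t e` on it, and `y ≤ t e` on its complement by `compl_bandProj_le`. -/
theorem smul_bandProj_le {y e : E} {t : ℝ} :
    t • bandProj (y - t • e)⁺ e ≤ bandProj (y - t • e)⁺ y := by
  rw [← sub_nonneg, ← map_smul, ← map_sub, bandProj_posPart]
  exact posPart_nonneg _

theorem compl_bandProj_le {y e : E} {t : ℝ} :
    (1 - bandProj (y - t • e)⁺) y ≤ t • (1 - bandProj (y - t • e)⁺) e := by
  rw [← sub_nonpos, ← map_smul, ← map_sub, LinearMap.sub_apply, bandProj_posPart,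
    Module.End.one_apply, sub_nonpos]
  exact le_posPart _

/-! ### Conditional expectations: order closed range and averaging -/

namespace IsConditionalExpectation

variable {W : E →ₗ[ℝ] E}

theorem mono (hW : IsConditionalExpectation W) {x y : E} (h : x ≤ y) : W x ≤ W y := by
  have := hW.positive _ (sub_nonneg.mpr h)
  rwa [map_sub, sub_nonneg] at this

theorem mem_range_iff (hW : IsConditionalExpectation W) {x : E} :
    x ∈ LinearMap.range W ↔ W x = x :=
  ⟨by rintro ⟨y, rfl⟩; exact hW.projection y, fun h => ⟨x, h⟩⟩

theorem map_sup (hW : IsConditionalExpectation W) {x y : E} (hx : W x = x) (hy : W y = y) :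
    W (x ⊔ y) = x ⊔ y :=
  hW.mem_range_iff.mp (hW.range_sup _ ⟨x, hx⟩ _ ⟨y, hy⟩)

theorem map_inf (hW : IsConditionalExpectation W) {x y : E} (hx : W x = x) (hy : W y = y) :
    W (x ⊓ y) = x ⊓ y := by
  rw [eq_sub_of_add_eq (inf_add_sup x y), map_sub, map_add, hx, hy, hW.map_sup hx hy]

theorem map_posPart (hW : IsConditionalExpectation W) {x : E} (hx : W x = x) : W x⁺ = x⁺ :=
  hW.map_sup hx (map_zero W)

theorem isGLB_image (hW : IsConditionalExpectation W) {D : Set E} (hne : D.Nonempty)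
    (hD : DirectedOn (· ≥ ·) D) {s : E} (hs : IsGLB D s) : IsGLB (W '' D) (W s) := by
  have h := hW.orderContinuous ((fun d => d - s) '' D) (hne.image _) (by
    rintro _ ⟨a, ha, rfl⟩ _ ⟨b, hb, rfl⟩
    obtain ⟨c, hc, hca, hcb⟩ := hD a ha b hb
    exact ⟨_, ⟨c, hc, rfl⟩, sub_le_sub_right hca s, sub_le_sub_right hcb s⟩)
    ⟨by rintro _ ⟨a, ha, rfl⟩; exact sub_nonneg.mpr (hs.1 ha), fun b hb => by
      have : b + s ≤ s := hs.2 fun a ha => le_sub_iff_add_le.mp (hb ⟨a, ha, rfl⟩)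
      simpa using this⟩
  refine ⟨by rintro _ ⟨a, ha, rfl⟩; exact hW.mono (hs.1 ha), fun b hb => ?_⟩
  rw [← sub_nonpos]
  refine h.2 ?_
  rintro _ ⟨_, ⟨a, ha, rfl⟩, rfl⟩
  rw [map_sub]
  exact sub_le_sub_right (hb ⟨a, ha, rfl⟩) _

theorem isLUB_image (hW : IsConditionalExpectation W) {D : Set E} (hne : D.Nonempty)
    (hD : DirectedOn (· ≤ ·) D) {s : E} (hs : IsLUB D s) : IsLUB (W '' D) (W s) := by
  have h := hW.orderContinuous ((fun d => s - d) '' D) (hne.image _) (by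
    rintro _ ⟨a, ha, rfl⟩ _ ⟨b, hb, rfl⟩
    obtain ⟨c, hc, hca, hcb⟩ := hD a ha b hb
    exact ⟨_, ⟨c, hc, rfl⟩, sub_le_sub_left hca s, sub_le_sub_left hcb s⟩)
    ⟨by rintro _ ⟨a, ha, rfl⟩; exact sub_nonneg.mpr (hs.1 ha), fun b hb => by
      have : s ≤ s - b := hs.2 fun a ha => le_sub_comm.mp (hb ⟨a, ha, rfl⟩)
      simpa using this⟩
  refine ⟨by rintro _ ⟨a, ha, rfl⟩; exact hW.mono (hs.1 ha), fun b hb => ?_⟩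
  rw [← sub_nonpos]
  refine h.2 ?_
  rintro _ ⟨_, ⟨a, ha, rfl⟩, rfl⟩
  rw [map_sub]
  exact sub_le_sub_left (hb ⟨a, ha, rfl⟩) _

theorem isLUB_image_inf_nsmul (hW : IsConditionalExpectation W) {x y s : E} (hy : 0 ≤ y)
    (hs : IsLUB (Set.range fun n : ℕ => x ⊓ n • y) s) :
    IsLUB (Set.range fun n : ℕ => W (x ⊓ n • y)) (W s) := by
  have hmono : Monotone fun n : ℕ => x ⊓ n • y := fun m n h =>
    inf_le_inf_left x (nsmul_le_nsmul_left hy h)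
  have := hW.isLUB_image (Set.range_nonempty _) hmono.directed_le.directedOn_range hs
  rwa [← Set.range_comp] at this

/-- The band projection of a fixed element, along the band generated by a fixed element, is again
fixed, because the range of a conditional expectation is an order closed Riesz subspace. -/
theorem map_bandProj (hW : IsConditionalExpectation W) {x e : E} (hx : 0 ≤ x) (he : 0 ≤ e)
    (hWx : W x = x) (hWe : W e = e) : W (bandProj x e) = bandProj x e := by
  have h1 := isLUB_bandProj x he
  rw [abs_of_nonneg hx] at h1
  have h2 := hW.isLUB_image_inf_nsmul hx h1
  have h3 : (fun n : ℕ => W (e ⊓ n • x)) = fun n : ℕ => e ⊓ n • x := by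
    funext n
    exact hW.map_inf hWe (by rw [map_nsmul, hWx])
  rw [h3] at h2
  exact h2.unique h1

/-- The averaging property: `W` commutes with every band projection `P` such that `P e ∈ R(W)`. -/
theorem map_bandProjection (hW : IsConditionalExpectation W) {e : E} (he : IsWeakOrderUnit e)
    (hWe : W e = e) {P : E →ₗ[ℝ] E} (hP : IsBandProjection P) (hPe : W (P e) = P e) (x : E) :
    W (P x) = P (W x) := by
  -- By order continuity it suffices to look at elements below a multiple of `P e`.
  have key : ∀ {P : E →ₗ[ℝ] E}, IsBandProjection P → W (P e) = P e → ∀ x, 0 ≤ x →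
      P (W (P x)) = W (P x) := by
    intro P hP hPe x hx
    have hz := hP.positive x hx
    refine le_antisymm (hP.le_id _ (hW.positive _ hz)) ?_
    refine (hW.isLUB_image_inf_nsmul he.1 (he.isLUB_inf_nsmul hz)).2 ?_
    rintro _ ⟨n, rfl⟩
    have h0 : 0 ≤ P x ⊓ n • e := le_inf hz (nsmul_nonneg he.1 n)
    have h1 : P x ⊓ n • e ≤ P (n • e) := by
      rw [← hP.eq_self_of_le h0 inf_le_left]
      exact hP.mono inf_le_right
    have h2 : W (P x ⊓ n • e) ≤ P (n • e) := by
      refine (hW.mono h1).trans_eq ?_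
      rw [map_nsmul, map_nsmul, hPe]
    change W (P x ⊓ n • e) ≤ _
    rw [← hP.eq_self_of_le (hW.positive _ h0) h2]
    exact hP.mono (hW.mono inf_le_left)
  refine apply_eq_of_nonneg (f := W ∘ₗ P) (g := P ∘ₗ W) (fun x hx => ?_) x
  have h1 := key hP hPe x hx
  have h2 := key hP.compl (by simp [hPe, hWe]) x hx
  simp only [LinearMap.sub_apply, Module.End.one_apply, map_sub, h1] at h2
  rw [sub_self, sub_zero] at h2
  exact (sub_right_injective h2).symm

end IsConditionalExpectation

theorem isConditionalExpectation_id : IsConditionalExpectation (LinearMap.id : E →ₗ[ℝ] E) where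
  positive _ h := h
  orderContinuous D _ _ h := by simpa using h
  projection _ := rfl
  range_sup f _ g _ := ⟨f ⊔ g, rfl⟩
  range_complete D hne hD := by
    have hs := isLUB_csSup (hne.image Subtype.val) (by
      obtain ⟨b, hb⟩ := hD
      exact ⟨b, by rintro _ ⟨d, hd, rfl⟩; exact hb hd⟩)
    exact ⟨⟨sSup (Subtype.val '' D), _, rfl⟩, fun d hd => hs.1 ⟨d, hd, rfl⟩, fun b hb =>
      hs.2 (by rintro _ ⟨d, hd, rfl⟩; exact hb hd)⟩
  weakOrderUnit _ h := h

/-! ### Comparison on spectral slices -/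

/-- Two elements are compared by comparing them on the spectral slices
`{i ε < b ≤ (i + 1) ε}` of an element `b ≥ 0` of the range of a conditional expectation `W`, on
which `b` is constant up to `ε`. The projections onto these slices commute with `W`. -/
theorem le_of_forall_slice {W : E →ₗ[ℝ] E} (hW : IsConditionalExpectation W) {e : E}
    (he : IsWeakOrderUnit e) (hWe : W e = e) {b : E} (hb : 0 ≤ b) (hWb : W b = b) {ε : ℝ}
    (hε : 0 < ε) {x y : E}
    (h : ∀ K : E →ₗ[ℝ] E, IsBandProjection K → (∀ z, W (K z) = K (W z)) → ∀ t : ℝ, 0 ≤ t →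
      t • K e ≤ b → K b ≤ (t + ε) • K e → K x ≤ K y) : x ≤ y := by
  let B : ℕ → E →ₗ[ℝ] E := fun n => bandProj (b - ((n : ℝ) * ε) • e)⁺
  have hB : ∀ n, IsBandProjection (B n) := fun n => isBandProjection_bandProj _
  have hcomm : ∀ n z, W (B n z) = B n (W z) := fun n z =>
    hW.map_bandProjection he hWe (hB n) (hW.map_bandProj (posPart_nonneg _) he.1
      (hW.map_posPart (by rw [map_sub, map_smul, hWb, hWe])) hWe) z
  have hle : ∀ n : ℕ, ((n : ℝ) * ε) • B n e ≤ b := fun n =>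
    smul_bandProj_le.trans ((hB n).le_id b hb)
  have hz : ∀ n, B n (x - y)⁺ = (x - y)⁺ := by
    intro n
    induction n with
    | zero =>
      have hb0 : B 0 b = b := by
        simp only [B, Nat.cast_zero, zero_mul, zero_smul, sub_zero, posPart_of_nonneg hb,
          bandProj_self]
      have h1 := h (1 - B 0) (hB 0).compl (fun z => by simp [hcomm]) 0 le_rfl (by simpa using hb)
        (by
          rw [LinearMap.sub_apply, Module.End.one_apply, hb0, sub_self, zero_add]
          exact smul_nonneg hε.le ((hB 0).compl.positive e he.1))
      have h2 := (hB 0).compl.map_posPart_eq_zero (x := x - y) (by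
        rw [map_sub]
        exact sub_nonpos.mpr h1)
      exact (sub_eq_zero.mp h2).symm
    | succ n ih =>
      have hD := (hB (n + 1)).compl
      have h1 := h _ ((hB n).comp hD) (fun z => by simp [hcomm]) (n * ε) (by positivity)
        ((smul_le_smul_of_nonneg_left ((hB n).mono (hD.le_id e he.1)) (by positivity)).trans
          (hle n))
        (by
          have h3 : (n : ℝ) * ε + ε = ((n + 1 : ℕ) : ℝ) * ε := by push_cast; ring
          rw [h3, LinearMap.comp_apply, LinearMap.comp_apply, ← map_smul]
          exact (hB n).mono compl_bandProj_le)
      have h2 := ((hB n).comp hD).map_posPart_eq_zero (x := x - y) (by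
        rw [map_sub]
        exact sub_nonpos.mpr h1)
      rw [LinearMap.comp_apply, (hB n).comm hD, ih] at h2
      exact (sub_eq_zero.mp h2).symm
  -- The positive part of `x - y` lives where `b > n ε`, for all `n`.
  have hw0 : 0 ≤ e ⊓ (x - y)⁺ := le_inf he.1 (posPart_nonneg _)
  have hw : ε • (e ⊓ (x - y)⁺) ≤ 0 := by
    refine nonpos_of_forall_nsmul_le (b := b) fun n => ?_
    rw [← Nat.cast_smul_eq_nsmul ℝ, smul_smul]
    refine le_trans (smul_le_smul_of_nonneg_left ?_ (by positivity)) (hle n)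
    rw [← (hB n).eq_self_of_le hw0 (inf_le_right.trans_eq (hz n).symm)]
    exact (hB n).mono inf_le_left
  have hw' : e ⊓ (x - y)⁺ = 0 := by
    refine le_antisymm ?_ hw0
    have := smul_le_smul_of_nonneg_left hw (inv_nonneg.mpr hε.le)
    rwa [smul_smul, inv_mul_cancel₀ hε.ne', one_smul, smul_zero] at this
  have := he.2 (x - y)⁺ (by rwa [abs_of_nonneg (posPart_nonneg _)])
  exact sub_nonpos.mp (posPart_eq_zero.mp this)

/-! ### The product with unit `e` -/

/-- On a band where `b ≥ t e`, the product `a · b` dominates `t a`. The slices of `a` supply the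
components of `e` that occur in the definition of the product. -/
theorem IsBandProjection.smul_map_le_unitProd {e a b : E} (he : IsWeakOrderUnit e) (ha : 0 ≤ a)
    (hae : a ≤ e) (hb : 0 ≤ b) {J : E →ₗ[ℝ] E} (hJ : IsBandProjection J) {t : ℝ} (ht : 0 ≤ t)
    (htb : t • J e ≤ b) : t • J a ≤ unitProd e a b := by
  refine le_of_forall_pos_le_add_smul (smul_nonneg ht he.1) fun ε hε => ?_
  refine le_of_forall_slice isConditionalExpectation_id he rfl ha rfl hε ?_
  intro K hK _ s hs hsa hKa
  have hKJ := hK.comp hJ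
  have hmem : (s * t) • K (J e) ≤ unitProd e a b := by
    refine (isLUB_unitProd ha hae hb).1 ⟨K (J e), s, t, hKJ.disjoint_compl he.1 he.1, hs, ht,
      ?_, ?_, rfl⟩
    · have := hJ.mono hsa
      rw [map_smul, ← hK.comm hJ] at this
      exact this.trans (hJ.le_id a ha)
    · exact (smul_le_smul_of_nonneg_left (hK.le_id _ (hJ.positive e he.1)) ht).trans htb
  have hmem' := hK.mono hmem
  rw [map_smul, hK.projection] at hmem'
  have h1 : t • J (K a) ≤ t • J ((s + ε) • K e) :=
    smul_le_smul_of_nonneg_left (hJ.mono hKa) ht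
  have h2 : K (J e) ≤ K e := hK.mono (hJ.le_id e he.1)
  calc K (t • J a) = t • J (K a) := by rw [map_smul, hK.comm hJ]
    _ ≤ t • J ((s + ε) • K e) := h1
    _ = (s * t) • K (J e) + ε • t • K (J e) := by
      rw [map_smul, ← hK.comm hJ]
      module
    _ ≤ K (unitProd e a b) + ε • t • K e :=
      add_le_add hmem' (smul_le_smul_of_nonneg_left (smul_le_smul_of_nonneg_left h2 ht) hε.le)
    _ = K (unitProd e a b + ε • t • e) := by rw [map_add, map_smul, map_smul]

/-- To bound `x` by the product `a · b` with `b ∈ R(T)`, it suffices to bound it by `t a` on every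
band where `b ≤ t e`. -/
theorem le_unitProd {T : E →ₗ[ℝ] E} (hT : IsConditionalExpectation T) {e a b x : E}
    (he : IsWeakOrderUnit e) (hTe : T e = e) (ha : 0 ≤ a) (hae : a ≤ e) (hb : 0 ≤ b)
    (hTb : T b = b)
    (h : ∀ J : E →ₗ[ℝ] E, IsBandProjection J → (∀ z, T (J z) = J (T z)) → ∀ t : ℝ, 0 ≤ t →
      J b ≤ t • J e → J x ≤ t • J a) : x ≤ unitProd e a b := by
  refine le_of_forall_pos_le_add_smul ha fun ε hε => ?_
  refine le_of_forall_slice hT he hTe hb hTb hε fun J hJ hTJ t ht htb hJb => ?_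
  have h1 := hJ.mono (hJ.smul_map_le_unitProd he ha hae hb ht htb)
  rw [map_smul, hJ.projection] at h1
  calc J x ≤ (t + ε) • J a := h J hJ hTJ _ (by positivity) hJb
    _ = t • J a + ε • J a := add_smul _ _ _
    _ ≤ J (unitProd e a b) + ε • J a := add_le_add_left h1 _
    _ = J (unitProd e a b + ε • a) := by rw [map_add, map_smul]

/-- The half of the identity `T P e · b = T P b`, for `b ∈ R(T)₊`, that the covariance estimate
needs. -/
theorem unitProd_le_map {T : E →ₗ[ℝ] E} (hT : IsConditionalExpectation T) {e b : E}
    (he : IsWeakOrderUnit e) (hTe : T e = e) {P : E →ₗ[ℝ] E} (hP : IsBandProjection P)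
    (hb : 0 ≤ b) (hTb : T b = b) : unitProd e (T (P e)) b ≤ T (P b) := by
  have hPe : 0 ≤ T (P e) := hT.positive _ (hP.positive e he.1)
  have hPe' : T (P e) ≤ e := (hT.mono (hP.le_id e he.1)).trans_eq hTe
  refine (isLUB_unitProd hPe hPe' hb).2 ?_
  rintro _ ⟨p, s, t, hp, hs, ht, hsa, htb, rfl⟩
  have hp0 : 0 ≤ p := hp ▸ inf_le_left
  have hpe : 0 ≤ e - p := hp ▸ inf_le_right
  -- `J` is the band projection with `J e = p`, and `c = (t e - b)⁺` vanishes on its band.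
  have hJ := isBandProjection_bandProj p
  set J := bandProj p
  have hJp : J p = p := bandProj_self p
  have hJe : J e = p := by
    have h1 : J (e - p) = 0 := bandProj_of_disjoint (by
      rwa [abs_of_nonneg hpe, abs_of_nonneg hp0, inf_comm])
    rwa [map_sub, hJp, sub_eq_zero] at h1
  have hJc : J (t • e - b)⁺ = 0 := hJ.map_posPart_eq_zero (by
    have h1 := hJ.mono htb
    rw [map_smul, hJp] at h1
    rwa [map_sub, map_smul, hJe, sub_nonpos])
  have hTc : T (t • e - b)⁺ = (t • e - b)⁺ :=
    hT.map_posPart (by rw [map_sub, map_smul, hTb, hTe])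
  have h1 : t • T (P e) ≤ T (P b) + (t • e - b)⁺ := by
    have h2 := hT.mono (hP.mono (le_posPart (t • e - b)))
    have h3 := hT.mono (hP.le_id _ (posPart_nonneg (t • e - b)))
    rw [hTc] at h3
    rw [map_sub, map_sub, map_smul, map_smul] at h2
    exact sub_le_iff_le_add'.mp (h2.trans h3)
  have h4 := hJ.mono h1
  rw [map_add, hJc, add_zero, map_smul] at h4
  have h5 := hJ.mono hsa
  rw [map_smul, hJp] at h5
  calc (s * t) • p = t • s • p := by module
    _ ≤ t • J (T (P e)) := smul_le_smul_of_nonneg_left h5 ht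
    _ ≤ J (T (P b)) := h4
    _ ≤ T (P b) := hJ.le_id _ (hT.positive _ (hP.positive b hb))

/-! ### Approximation by step elements -/

/-- Layer-cake approximation, with `sum_bandProj_le`: if `0 ≤ y ≤ n e`, the sum of the components of
`e` on which `y > i e`, `i < n`, lies between `y` and `y + e`. Each term is compared with a
telescoping difference of the elements `(y - i e)⁺`. -/
theorem le_sum_bandProj {e y : E} {n : ℕ} (hy : 0 ≤ y) (hyn : y ≤ (n : ℝ) • e) :
    y ≤ ∑ i ∈ Finset.range n, bandProj (y - (i : ℝ) • e)⁺ e := by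
  have h : ∀ i ∈ Finset.range n, (y - (i : ℝ) • e)⁺ - (y - ((i + 1 : ℕ) : ℝ) • e)⁺ ≤
      bandProj (y - (i : ℝ) • e)⁺ e := by
    intro i _
    have hQ := isBandProjection_bandProj (y - (i : ℝ) • e)⁺
    have h1 := hQ.mono (le_posPart (y - ((i + 1 : ℕ) : ℝ) • e))
    have h2 : y - ((i + 1 : ℕ) : ℝ) • e = (y - (i : ℝ) • e) - e := by push_cast; module
    have h3 := h1.trans (hQ.le_id _ (posPart_nonneg _))
    rw [h2] at h3 ⊢
    rw [map_sub, bandProj_posPart] at h3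
    exact sub_le_comm.mp h3
  have := Finset.sum_le_sum h
  rw [Finset.sum_range_sub' (fun i : ℕ => (y - (i : ℝ) • e)⁺)] at this
  simpa [posPart_of_nonneg hy, posPart_eq_zero.mpr (sub_nonpos.mpr hyn)] using this

theorem sum_bandProj_le {e y : E} (he : 0 ≤ e) (hy : 0 ≤ y) (n : ℕ) :
    ∑ i ∈ Finset.range n, bandProj (y - (i : ℝ) • e)⁺ e ≤ y + e := by
  have h : ∀ i ∈ Finset.range n, bandProj (y - (i : ℝ) • e)⁺ e ≤
      (y + e - (i : ℝ) • e)⁺ - (y + e - ((i + 1 : ℕ) : ℝ) • e)⁺ := by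
    intro i _
    have hQ := isBandProjection_bandProj (y - (i : ℝ) • e)⁺
    have h1 := (hQ.mono (le_posPart (y + e - (i : ℝ) • e))).trans
      (hQ.le_id _ (posPart_nonneg _))
    have h2 : y + e - ((i + 1 : ℕ) : ℝ) • e = y - (i : ℝ) • e := by push_cast; module
    have h3 : bandProj (y - (i : ℝ) • e)⁺ (y + e - (i : ℝ) • e) =
        bandProj (y - (i : ℝ) • e)⁺ e + (y - (i : ℝ) • e)⁺ := by
      rw [add_sub_right_comm, map_add, bandProj_posPart, add_comm]
    rw [h2]
    rw [h3] at h1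
    exact le_sub_iff_add_le.mpr h1
  have := Finset.sum_le_sum h
  rw [Finset.sum_range_sub' (fun i : ℕ => (y + e - (i : ℝ) • e)⁺)] at this
  refine this.trans ?_
  simp only [Nat.cast_zero, zero_smul, sub_zero]
  rw [posPart_of_nonneg (add_nonneg hy he)]
  exact sub_le_self _ (posPart_nonneg _)

/-! ### The conditional covariance with a band projection -/

/-- The `T`-conditional covariance `T (P e · x) - T (P e) · T x` of the component `P e` with `x`,
written without products: `P` acts as multiplication by `P e`, so it is `T P x - T P T x`. -/
def conditionalCov (T P : E →ₗ[ℝ] E) : E →ₗ[ℝ] E := T ∘ₗ P - T ∘ₗ P ∘ₗ T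

theorem conditionalCov_apply (T P : E →ₗ[ℝ] E) (x : E) :
    conditionalCov T P x = T (P x) - T (P (T x)) := rfl

theorem neg_conditionalCov_le {T P : E →ₗ[ℝ] E} (hT : IsConditionalExpectation T)
    (hP : IsBandProjection P) {e r : E} (hTe : T e = e) (hr : 0 ≤ r) (hre : r ≤ e) :
    -conditionalCov T P r ≤ e := by
  rw [conditionalCov_apply, neg_sub]
  calc T (P (T r)) - T (P r) ≤ T (P (T r)) := sub_le_self _ (hT.positive _ (hP.positive r hr))
    _ ≤ T (T r) := hT.mono (hP.le_id _ (hT.positive r hr))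
    _ = T r := hT.projection r
    _ ≤ e := (hT.mono hre).trans_eq hTe

section Mixing

variable {e : E} {T U V P : E →ₗ[ℝ] E}

theorem strongMixing_nonneg (he : 0 ≤ e) (hT : IsConditionalExpectation T) (hTe : T e = e) :
    0 ≤ strongMixing e T U V := by
  have h0 : ∀ W : E →ₗ[ℝ] E, (0 : E →ₗ[ℝ] E) ∈ bandProjections e W := fun W =>
    ⟨⟨fun _ => rfl, fun _ _ => le_rfl, fun _ h => h⟩, zero_mem _⟩
  exact (abs_nonneg _).trans
    ((isLUB_strongMixing he hT hTe).1.1 ⟨0, h0 U, 0, h0 V, rfl⟩)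

theorem conditionalCov_map_le_strongMixing (he : IsWeakOrderUnit e)
    (hT : IsConditionalExpectation T) (hTe : T e = e) (hP : P ∈ bandProjections e U)
    {Q : E →ₗ[ℝ] E} (hQ : Q ∈ bandProjections e V) :
    conditionalCov T P (Q e) ≤ strongMixing e T U V := by
  refine le_trans ?_ ((isLUB_strongMixing he.1 hT hTe).1.1 ⟨P, hP, Q, hQ, rfl⟩)
  refine le_trans ?_ (le_abs_self _)
  exact sub_le_sub_left (unitProd_le_map hT he hTe hP.1
    (hT.positive _ (hQ.1.positive e he.1)) (hT.projection _)) _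

/-- The covariance estimate with an additive error `e`: a nonnegative `y ≤ n e` in `R(V)` lies
within `e` of a sum of `n` components of `e` in `R(V)`, and the covariance of each of these is at
most `α_T(U, V)`. -/
theorem conditionalCov_le_nsmul_add (he : IsWeakOrderUnit e) (hT : IsConditionalExpectation T)
    (hTe : T e = e) (hV : IsConditionalExpectation V) (hVe : V e = e)
    (hP : P ∈ bandProjections e U) {y : E} (hVy : V y = y) {n : ℕ} (hy : 0 ≤ y)
    (hyn : y ≤ (n : ℝ) • e) :
    conditionalCov T P y ≤ (n : ℝ) • strongMixing e T U V + e := by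
  set S := ∑ i ∈ Finset.range n, bandProj (y - (i : ℝ) • e)⁺ e with hS
  have h1 : conditionalCov T P S ≤ (n : ℝ) • strongMixing e T U V := by
    rw [hS, map_sum, Nat.cast_smul_eq_nsmul]
    refine (Finset.sum_le_card_nsmul _ _ (strongMixing e T U V) fun i _ => ?_).trans_eq
      (by rw [Finset.card_range])
    refine conditionalCov_map_le_strongMixing he hT hTe hP
      ⟨isBandProjection_bandProj _, hV.mem_range_iff.mpr ?_⟩
    exact hV.map_bandProj (posPart_nonneg _) he.1
      (hV.map_posPart (by rw [map_sub, map_smul, hVy, hVe])) hVe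
  have h2 := neg_conditionalCov_le (r := S - y) hT hP.1 hTe
    (sub_nonneg.mpr (le_sum_bandProj hy hyn)) (sub_le_iff_le_add'.mpr (sum_bandProj_le he.1 hy n))
  calc conditionalCov T P y = conditionalCov T P S + -conditionalCov T P (S - y) := by
        rw [map_sub]; abel
    _ ≤ _ := add_le_add h1 h2

/-- The covariance estimate for bounded elements of `R(V)`. -/
theorem conditionalCov_le (he : IsWeakOrderUnit e) (hT : IsConditionalExpectation T)
    (hTe : T e = e) (hV : IsConditionalExpectation V) (hVe : V e = e)
    (hP : P ∈ bandProjections e U) {x : E} (hVx : V x = x) {c : ℝ} (hc : 0 ≤ c)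
    (hx : |x| ≤ c • e) :
    conditionalCov T P x ≤ (2 * c) • strongMixing e T U V := by
  have hα := (isLUB_strongMixing (U := U) (V := V) he.1 hT hTe).2
  have hα0 := strongMixing_nonneg (U := U) (V := V) he.1 hT hTe
  set α := strongMixing e T U V
  have hcov_e : conditionalCov T P e = 0 := by rw [conditionalCov_apply, hTe, sub_self]
  -- Apply the estimate with additive error to `m (x + c e)` and let `m` tend to infinity.
  rw [← sub_nonpos]
  refine nonpos_of_forall_nsmul_le (b := (2 : ℝ) • e) fun m => ?_
  have hm : (0 : ℝ) ≤ m := m.cast_nonneg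
  have h0 : 0 ≤ x + c • e := by
    have := neg_le_of_neg_le ((neg_le_abs x).trans hx)
    simpa using neg_le_iff_add_nonneg.mp this
  have h1 : x + c • e ≤ (2 * c) • e := by
    refine (add_le_add_left ((le_abs_self x).trans hx) _).trans_eq ?_
    module
  have h2 := conditionalCov_le_nsmul_add (y := (m : ℝ) • (x + c • e)) (n := ⌈m * (2 * c)⌉₊)
    he hT hTe hV hVe hP (by rw [map_smul, map_add, map_smul, hVx, hVe]) (smul_nonneg hm h0) (by
      refine (smul_le_smul_of_nonneg_left h1 hm).trans ?_
      rw [smul_smul]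
      exact smul_le_smul_of_nonneg_right (Nat.le_ceil _) he.1)
  rw [map_smul, map_add, map_smul, hcov_e, smul_zero, add_zero] at h2
  have h3 : (⌈m * (2 * c)⌉₊ : ℝ) • α ≤ (m * (2 * c) + 1) • α :=
    smul_le_smul_of_nonneg_right (Nat.ceil_lt_add_one (by positivity)).le hα0
  rw [← Nat.cast_smul_eq_nsmul ℝ, smul_sub, sub_le_iff_le_add]
  calc (m : ℝ) • conditionalCov T P x ≤ (⌈m * (2 * c)⌉₊ : ℝ) • α + e := h2
    _ ≤ (m * (2 * c) + 1) • α + e := add_le_add_left h3 _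
    _ = (m : ℝ) • (2 * c) • α + (α + e) := by module
    _ ≤ (m : ℝ) • (2 * c) • α + (e + e) := add_le_add_right (add_le_add_left hα _) _
    _ = (2 : ℝ) • e + (m : ℝ) • (2 * c) • α := by module

/-- The band projection onto the band where `U x > T x` expresses `T |U x - T x|` as a
covariance. -/
theorem map_abs_sub_eq_conditionalCov (he : IsWeakOrderUnit e)
    (hT : IsConditionalExpectation T) (hTe : T e = e) (hU : IsConditionalExpectation U)
    (hUT : IsCompatible U T) (x : E) :
    ∃ P ∈ bandProjections e U, T |U x - T x| = (2 : ℝ) • conditionalCov T P x := by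
  have hTU : ∀ z, T (U z) = T z := fun z => LinearMap.congr_fun hUT.1 z
  have hUT' : ∀ z, U (T z) = T z := fun z => LinearMap.congr_fun hUT.2 z
  have hUe : U e = e := by rw [← hTe, hUT']
  have hUh : U (U x - T x) = U x - T x := by rw [map_sub, hU.projection, hUT']
  have hTh : T (U x - T x) = 0 := by rw [map_sub, hTU, hT.projection, sub_self]
  set h := U x - T x with hh
  have hP := isBandProjection_bandProj h⁺
  have hPe : U (bandProj h⁺ e) = bandProj h⁺ e :=
    hU.map_bandProj (posPart_nonneg h) he.1 (hU.map_posPart hUh) hUe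
  refine ⟨bandProj h⁺, ⟨hP, hU.mem_range_iff.mpr hPe⟩, ?_⟩
  have habs : |h| = (2 : ℝ) • h⁺ - h := by
    rw [ofNat_smul_eq_nsmul, ← add_abs_eq_two_nsmul_posPart, add_sub_cancel_left]
  calc T |h| = (2 : ℝ) • T (bandProj h⁺ h) := by
        rw [habs, map_sub, hTh, sub_zero, map_smul, bandProj_posPart]
    _ = (2 : ℝ) • conditionalCov T (bandProj h⁺) x := by
        rw [conditionalCov_apply, ← hTU (bandProj h⁺ x),
          hU.map_bandProjection he hUe hP hPe, ← map_sub, ← map_sub]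

end Mixing

/-! ### The range of `T` contains the norm `‖f‖_{T,∞}` -/

theorem isGLB_normInfty {T : E →ₗ[ℝ] E} {f : E} (hf : f ∈ LInfty T) :
    IsGLB {g | g ∈ LinearMap.range T ∧ 0 ≤ g ∧ |f| ≤ g} (normInfty T f) :=
  isGLB_csInf hf ⟨0, fun _ h => h.2.1⟩

/-- `‖f‖_{T,∞}` is the infimum of a downwards directed subset of the order closed space `R(T)`. -/
theorem IsConditionalExpectation.map_normInfty {T : E →ₗ[ℝ] E} (hT : IsConditionalExpectation T)
    {f : E} (hf : f ∈ LInfty T) : T (normInfty T f) = normInfty T f := by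
  have h1 := isGLB_normInfty hf
  have h2 := hT.isGLB_image hf (by
    rintro a ⟨ha, ha0, hfa⟩ b ⟨hb, hb0, hfb⟩
    exact ⟨a ⊓ b, ⟨hT.mem_range_iff.mpr (hT.map_inf (hT.mem_range_iff.mp ha)
      (hT.mem_range_iff.mp hb)), le_inf ha0 hb0, le_inf hfa hfb⟩, inf_le_left, inf_le_right⟩) h1
  have h3 : T '' {g | g ∈ LinearMap.range T ∧ 0 ≤ g ∧ |f| ≤ g} =
      {g | g ∈ LinearMap.range T ∧ 0 ≤ g ∧ |f| ≤ g} :=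
    (Set.image_congr fun a ha => hT.mem_range_iff.mp ha.1).trans (Set.image_id' _)
  exact (h3 ▸ h2).unique h1

end Proof

end RieszMixing

open RieszMixing in
theorem theorem4p7 {E : Type*} [AddCommGroup E] [ConditionallyCompleteLattice E]
    [IsOrderedAddMonoid E] [Module ℝ E] [IsOrderedModule ℝ E]
    (e : E) (he : IsWeakOrderUnit e)
    (T : E →ₗ[ℝ] E) (hT : IsConditionalExpectation T) (hTe : e = T e)
    (hE : IsTUniversallyComplete T)
    (U V : E →ₗ[ℝ] E)
    (hU : IsConditionalExpectation U) (hUT : IsCompatible U T)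
    (hV : IsConditionalExpectation V) (hVT : IsCompatible V T)
    (f : E) (hfV : f ∈ LinearMap.range V) (hf : f ∈ LInfty T) :
    normOne T (U f - T f) ≤ (4 : ℝ) • unitProd e (strongMixing e T U V) (normInfty T f) := by
  have hTe' := hTe.symm
  have hVT' : ∀ z, V (T z) = T z := fun z => LinearMap.congr_fun hVT.2 z
  have hVe : V e = e := by rw [hTe, hVT']
  have hN := isGLB_normInfty hf
  have hfN : |f| ≤ normInfty T f := hN.2 fun g hg => hg.2.2
  obtain ⟨P, hP, hPf⟩ := map_abs_sub_eq_conditionalCov he hT hTe' hU hUT f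
  have key : (2 : ℝ)⁻¹ • conditionalCov T P f ≤
      unitProd e (strongMixing e T U V) (normInfty T f) := by
    refine le_unitProd hT he hTe' (strongMixing_nonneg he.1 hT hTe')
      (isLUB_strongMixing he.1 hT hTe').2 ((abs_nonneg f).trans hfN) (hT.map_normInfty hf) ?_
    intro J hJ hTJ t ht hJN
    -- `J e ∈ R(T)`, so `J` commutes with `V` too, and `J f` is an element of `R(V)` bounded by
    -- `t e`.
    have hTJe : T (J e) = J e := by rw [hTJ, hTe']
    have hVJ := hV.map_bandProjection he hVe hJ (by rw [← hTJe, hVT'])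
    have hJf : |J f| ≤ t • e :=
      ((hJ.abs_map_le f).trans (hJ.mono hfN)).trans
        (hJN.trans (smul_le_smul_of_nonneg_left (hJ.le_id e he.1) ht))
    have h1 := conditionalCov_le he hT hTe' hV hVe hP
      (by rw [hVJ, hV.mem_range_iff.mp hfV]) ht hJf
    have h2 : conditionalCov T P (J f) = J (conditionalCov T P f) := by
      simp only [conditionalCov_apply, map_sub, hP.1.comm hJ, hTJ]
    rw [h2] at h1
    have h3 := smul_le_smul_of_nonneg_left (hJ.mono h1) (show (0 : ℝ) ≤ 2⁻¹ by norm_num)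
    rw [hJ.projection, map_smul, smul_smul, inv_mul_cancel_left₀ two_ne_zero] at h3
    rwa [map_smul]
  calc normOne T (U f - T f) = (4 : ℝ) • (2 : ℝ)⁻¹ • conditionalCov T P f := by
        rw [normOne, hPf, smul_smul]; norm_num
    _ ≤ _ := smul_le_smul_of_nonneg_left key (by norm_num)
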